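/- Conventions. Let $X$ be a smooth finite-dimensional (Hausdorff, second countable) manifold, $n\ge 1$, and let $\omega\in\Omega^{n+1}(X)$ be closed; $(X,\omega)$ is called a pre-$n$-plectic manifold. Let $\mathfrak g$ be a real Lie algebra, possibly infinite-dimensional, and let $\rho:\mathfrak g\to\mathfrak X(X)$ be an infinitesimal action, i.e. a homomorphism of Lie algebras. The action is *premultisymplectic* if $\mathcal L_{\rho(a)}\omega=0$ for all $a\in\mathfrak g$. A form $\alpha\in\Omega^{n-1}(X)$ is *Hamiltonian* if $\iota_\chi\omega=-d\alpha$ for some vector field $\chi$ (a Hamiltonian vector field of $\alpha$). Let $L_\infty(X,\omega)$ be the $L_\infty$-algebra with degree $0$ part the Hamiltonian $(n-1)$-forms, degree $i$ part $\Omega^{n-1+i}(X)$ for $1-n\le i<0$ and zero otherwise, with brackets $l_1=d$ in negative degrees, $l_k(\alpha_1,\dots,\alpha_k)=-(-1)^{k(k+1)/2}\iota_{\chi_k}\cdots\iota_{\chi_1}\omega$ for $k>1$ and Hamiltonian forms $\alpha_i$ with Hamiltonian vector fields $\chi_i$, and $l_k=0$ in all other cases. A *homotopy momentum map* for a premultisymplectic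 action $\rho$ is a morphism of $L_\infty$-algebras $\mu:\mathfrak g\to L_\infty(X,\omega)$, with components $\mu_i:\wedge^i\mathfrak g\to L_\infty(X,\omega)$ of degree $1-i$, such that $\iota_{\rho(a)}\omega=-d\mu_1(a)$ for all $a\in\mathfrak g$. The action is *Hamiltonian* if it is premultisymplectic and admits a homotopy momentum map. Let $\Omega^{p,q}(\mathfrak g,X)=\mathrm{Hom}_{\mathbb R}(\wedge^p\mathfrak g,\Omega^q(X))$ for $p\ge1$, $q\ge0$, with $d_{\mathfrak g}\alpha=\alpha\circ\delta_{\mathrm{CE}}$ and $d_X\alpha=(-1)^p\,d\circ\alpha$ for $\alpha\in\Omega^{p,q}(\mathfrak g,X)$, where $\delta_{\mathrm{CE}}(a_1\wedge\dots\wedge a_k)=\sum_{i<j}(-1)^{i+j}[a_i,a_j]\wedge a_1\wedge\cdots\widehat{a_i}\cdots\widehat{a_j}\cdots\wedge a_k$. Let $\Omega^N(\mathfrak g,X)=\bigoplus_{p\ge 1,\,p+q=N}\Omega^{p,q}(\mathfrak g,X)$ be the total complex, with differential $\overline d=d_{\mathfrak g}+d_X$. Put $\omega_i(a_1\wedge\dots\wedge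 a_i)=\iota_{\rho(a_i)}\cdots\iota_{\rho(a_1)}\omega$ and $\overline\omega=\sum_{i=1}^{n+1}(-1)^{i-1}\omega_i\in\Omega^{n+1}(\mathfrak g,X)$. Theorem. In this situation: (i) The action $\rho$ is premultisymplectic if and only if $\overline d\,\overline\omega=0$. (ii) The action $\rho$ is Hamiltonian if and only if $\overline\omega$ is $\overline d$-exact, i.e. $\overline\omega=\overline d\nu$ for some $\nu\in\Omega^n(\mathfrak g,X)$. Moreover, for every $\nu=\sum_{i=1}^n\nu^{(i,n-i)}\in\Omega^n(\mathfrak g,X)$ with $\nu^{(i,n-i)}\in\Omega^{i,n-i}(\mathfrak g,X)$ and $\overline d\nu=\overline\omega$, the maps $\mu_i=-(-1)^{i(i+1)/2}\,\nu^{(i,n-i)}$, $1\le i\le n$, are the components of a homotopy momentum map for $\rho$. -/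

import Mathlib

open scoped Manifold ContDiff

noncomputable section

namespace Multisymp

/-! ### Chevalley–Eilenberg differential with trivial coefficients -/

section ChevalleyEilenberg

variable {𝔤 : Type*} [LieRing 𝔤] [LieAlgebra ℝ 𝔤] {V : Type*} [AddCommGroup V] [Module ℝ V]

/-- Auxiliary bilinear map `(a, b) ↦ α (⁅a, b⁆, …)`; only used to check that `ceDiff` is alternating. -/
def bracketInsert {k : ℕ} (α : 𝔤 [⋀^Fin (k + 1)]→ₗ[ℝ] V) :
    𝔤 →ₗ[ℝ] 𝔤 →ₗ[ℝ] 𝔤 [⋀^Fin k]→ₗ[ℝ] V :=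
  LinearMap.mk₂ ℝ (fun a b => α.curryLeft ⁅a, b⁆)
    (fun a a' b => by rw [add_lie, map_add]) (fun c a b => by rw [smul_lie, map_smul])
    (fun a b b' => by rw [lie_add, map_add]) (fun c a b => by rw [lie_smul, map_smul])

/-- The value of `α ∘ δ_CE` on `v_0 ∧ … ∧ v_k`, where
`δ_CE (v_0 ∧ … ∧ v_k) = ∑_{i < j} (-1)^{i + j} ⁅v_i, v_j⁆ ∧ v_0 ∧ ‥ v̂_i ‥ v̂_j ‥ ∧ v_k`.
The pair `i < j` is encoded by `i.castSucc < j.succ` with `i ≤ j`, whence the overall minus sign. -/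
def ceDiffFun : {k : ℕ} → (𝔤 [⋀^Fin k]→ₗ[ℝ] V) → (Fin (k + 1) → 𝔤) → V
  | 0, _, _ => 0
  | k + 1, α, v =>
      -∑ i : Fin (k + 1), ∑ j ∈ Finset.Ici i, (-1 : ℤ) ^ ((i : ℕ) + (j : ℕ)) •
        α (Matrix.vecCons ⁅v i.castSucc, v j.succ⁆ (j.removeNth (i.castSucc.removeNth v)))

theorem exists_ceDiff {k : ℕ} (α : 𝔤 [⋀^Fin k]→ₗ[ℝ] V) :
    ∃ β : 𝔤 [⋀^Fin (k + 1)]→ₗ[ℝ] V, ⇑β = ceDiffFun α := by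
  cases k with
  | zero => exact ⟨0, rfl⟩
  | succ k =>
    refine ⟨-((1 / 2 : ℝ) • AlternatingMap.alternatizeUncurryFin
      (AlternatingMap.alternatizeUncurryFinLM ∘ₗ bracketInsert α)), ?_⟩
    funext v
    rw [AlternatingMap.neg_apply, AlternatingMap.smul_apply,
      AlternatingMap.alternatizeUncurryFin_alternatizeUncurryFinLM_comp_apply, ceDiffFun,
      Finset.smul_sum]
    congr 1
    refine Finset.sum_congr rfl fun i _ => ?_
    rw [Finset.smul_sum]
    refine Finset.sum_congr rfl fun j _ => ?_
    simp only [bracketInsert, LinearMap.mk₂_apply, AlternatingMap.curryLeft_apply_apply]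
    rw [smul_comm]
    congr 1
    have h : ⁅v j.succ, v i.castSucc⁆ = (-1 : ℝ) • ⁅v i.castSucc, v j.succ⁆ := by
      rw [neg_one_smul, lie_skew]
    rw [h, AlternatingMap.map_vecCons_smul, neg_one_smul, sub_neg_eq_add, ← two_smul ℝ, smul_smul]
    norm_num

/-- `α ↦ α ∘ δ_CE`, from `Hom(Λ^k 𝔤, V)` to `Hom(Λ^{k+1} 𝔤, V)`. -/
def ceDiff {k : ℕ} (α : 𝔤 [⋀^Fin k]→ₗ[ℝ] V) : 𝔤 [⋀^Fin (k + 1)]→ₗ[ℝ] V where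
  toFun := ceDiffFun α
  map_update_add' v i x y := by
    obtain ⟨β, hβ⟩ := exists_ceDiff α
    rw [← hβ]; exact β.map_update_add' v i x y
  map_update_smul' v i c x := by
    obtain ⟨β, hβ⟩ := exists_ceDiff α
    rw [← hβ]; exact β.map_update_smul' v i c x
  map_eq_zero_of_eq' v i j h hij := by
    obtain ⟨β, hβ⟩ := exists_ceDiff α
    rw [← hβ]; exact β.map_eq_zero_of_eq' v i j h hij

end ChevalleyEilenberg

/-! ### Vector fields and differential forms

`A` is a commutative real algebra; for a manifold `X` it is `A = C^∞(X)`.  Vector fields on `X` are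
the derivations of `C^∞(X)`, with the commutator bracket, and `q`-forms on `X` are the alternating
`C^∞(X)`-multilinear maps `𝔛(X)^q → C^∞(X)`. -/

section Forms

variable (A : Type*) [CommRing A] [Algebra ℝ A]

/-- Vector fields `𝔛(X) = Der(C^∞(X))`. -/
abbrev VF := Derivation ℝ A A

/-- Differential `q`-forms. -/
abbrev Form (q : ℕ) := VF A [⋀^Fin q]→ₗ[A] A

variable {A}

/-- A form, regarded as an `ℝ`-multilinear alternating map. -/
def Form.toReal {q : ℕ} (α : Form A q) : VF A [⋀^Fin q]→ₗ[ℝ] A where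
  toFun := α
  map_update_add' := α.map_update_add'
  map_update_smul' v i c x := by
    have h : c • x = (algebraMap ℝ A c) • x := (algebraMap_smul A c x).symm
    rw [h, Algebra.smul_def]
    exact α.map_update_smul v i _ x
  map_eq_zero_of_eq' := α.map_eq_zero_of_eq'

/-- The de Rham differential, evaluated on vector fields:
`dα(v_0, …, v_q) = ∑_i (-1)^i v_i(α(‥ v̂_i ‥)) + ∑_{i<j} (-1)^{i+j} α([v_i, v_j], ‥ v̂_i ‥ v̂_j ‥)`. -/
def extDFun {q : ℕ} (α : Form A q) (v : Fin (q + 1) → VF A) : A :=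
  (∑ i : Fin (q + 1), (-1 : ℤ) ^ (i : ℕ) • v i (α (i.removeNth v))) + ceDiff α.toReal v

/-- The `ℝ`-linear map `v ↦ v ∘ α`; only used to check that `extD` is alternating. -/
def derivComp {q : ℕ} (α : Form A q) : VF A →ₗ[ℝ] VF A [⋀^Fin q]→ₗ[ℝ] A where
  toFun v := (v : A →ₗ[ℝ] A).compAlternatingMap α.toReal
  map_add' v w := by ext x; simp
  map_smul' c v := by ext x; simp

theorem extDFun_eq {q : ℕ} (α : Form A q) : extDFun α =
    ⇑(AlternatingMap.alternatizeUncurryFin (derivComp α) + ceDiff α.toReal) := by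
  funext v
  rw [AlternatingMap.add_apply, AlternatingMap.alternatizeUncurryFin_apply]
  rfl

theorem extDFun_cons_smul {q : ℕ} (α : Form A q) (f : A) (x : VF A) (w : Fin q → VF A) :
    extDFun α (Matrix.vecCons (f • x) w) = f • extDFun α (Matrix.vecCons x w) := by
  have hrem (r : ℕ) (y : VF A) (u : Fin (r + 1) → VF A) (i : Fin (r + 1)) :
      i.succ.removeNth (Matrix.vecCons y u : Fin (r + 2) → VF A) =
        Matrix.vecCons y (i.removeNth u) := by
    funext k
    cases k using Fin.cases <;> simp [Fin.removeNth_apply]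
  have hrem0 (r : ℕ) (y : VF A) (u : Fin r → VF A) :
      (0 : Fin (r + 1)).removeNth (Matrix.vecCons y u : Fin (r + 1) → VF A) = u := rfl
  cases q with
  | zero => simp [extDFun, ceDiff, ceDiffFun, hrem0]
  | succ q =>
    have hlie (y : VF A) : ⁅f • x, y⁆ = f • ⁅x, y⁆ + (-(y f)) • x := by
      ext a
      simp [Derivation.commutator_apply, Derivation.leibniz]
      ring
    have hinner (i : Fin q) (j : Fin (q + 1)) (hj : i.succ ≤ j) (b : VF A) :
        α (Matrix.vecCons b (j.removeNth (i.succ.castSucc.removeNth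
          (Matrix.vecCons (f • x) w : Fin (q + 2) → VF A)))) =
        f * α (Matrix.vecCons b (j.removeNth (i.succ.castSucc.removeNth
          (Matrix.vecCons x w : Fin (q + 2) → VF A)))) := by
      cases q with
      | zero => exact i.elim0
      | succ r =>
        obtain ⟨j, rfl⟩ := Fin.exists_succ_eq.2 (Fin.pos_iff_ne_zero.1
          (lt_of_lt_of_le (Fin.succ_pos i) hj))
        rw [Fin.castSucc_succ, hrem, hrem, hrem, hrem]
        exact AlternatingMap.map_vecCons_smul (α.curryLeft b) _ f x
    have hce (y : VF A) : extDFun α (Matrix.vecCons y w) = y (α w)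
        + (∑ i : Fin (q + 1), (-1 : ℤ) ^ ((i : ℕ) + 1) •
            w i (α (Matrix.vecCons y (i.removeNth w))))
        - ((∑ j : Fin (q + 1), (-1 : ℤ) ^ (j : ℕ) •
            α (Matrix.vecCons ⁅y, w j⁆ (j.removeNth w))) +
          ∑ i : Fin q, ∑ j ∈ Finset.Ici i.succ, (-1 : ℤ) ^ ((i.succ : ℕ) + (j : ℕ)) •
            α (Matrix.vecCons ⁅w i.castSucc, w j⁆ (j.removeNth (i.succ.castSucc.removeNth
          (Matrix.vecCons y w : Fin (q + 2) → VF A))))) := by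
      rw [extDFun, Fin.sum_univ_succ, sub_eq_add_neg]
      congr 1
      · simp only [hrem, hrem0]
        simp
      · change -_ = -_
        rw [Fin.sum_univ_succ]
        have h0 : Finset.Ici (0 : Fin (q + 1)) = Finset.univ := by ext; simp
        rw [h0]
        simp only [Fin.castSucc_zero, hrem0, Fin.val_zero, zero_add]
        rfl
    have h2 : ∑ i : Fin q, ∑ j ∈ Finset.Ici i.succ, (-1 : ℤ) ^ ((i.succ : ℕ) + (j : ℕ)) •
            α (Matrix.vecCons ⁅w i.castSucc, w j⁆ (j.removeNth (i.succ.castSucc.removeNth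
          (Matrix.vecCons (f • x) w : Fin (q + 2) → VF A)))) =
        f * ∑ i : Fin q, ∑ j ∈ Finset.Ici i.succ, (-1 : ℤ) ^ ((i.succ : ℕ) + (j : ℕ)) •
            α (Matrix.vecCons ⁅w i.castSucc, w j⁆ (j.removeNth (i.succ.castSucc.removeNth
          (Matrix.vecCons x w : Fin (q + 2) → VF A)))) := by
      simp only [Finset.mul_sum]
      refine Finset.sum_congr rfl fun i _ => Finset.sum_congr rfl fun j hj => ?_
      rw [hinner i j (Finset.mem_Ici.1 hj), mul_smul_comm]
    rw [hce, hce, h2]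
    have h1 : ∑ i : Fin (q + 1), (-1 : ℤ) ^ ((i : ℕ) + 1) •
            w i (α (Matrix.vecCons (f • x) (i.removeNth w))) -
          ∑ j : Fin (q + 1), (-1 : ℤ) ^ (j : ℕ) •
            α (Matrix.vecCons ⁅f • x, w j⁆ (j.removeNth w)) =
        f * (∑ i : Fin (q + 1), (-1 : ℤ) ^ ((i : ℕ) + 1) •
            w i (α (Matrix.vecCons x (i.removeNth w))) -
          ∑ j : Fin (q + 1), (-1 : ℤ) ^ (j : ℕ) •
            α (Matrix.vecCons ⁅x, w j⁆ (j.removeNth w))) := by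
      rw [← Finset.sum_sub_distrib, ← Finset.sum_sub_distrib, Finset.mul_sum]
      refine Finset.sum_congr rfl fun i _ => ?_
      rw [hlie, AlternatingMap.map_vecCons_add, AlternatingMap.map_vecCons_smul,
        AlternatingMap.map_vecCons_smul, AlternatingMap.map_vecCons_smul]
      simp only [smul_eq_mul, Derivation.leibniz, zsmul_eq_mul, pow_succ]
      push_cast
      ring
    have h3 : (f • x) (α w) = f * x (α w) := rfl
    rw [h3, smul_eq_mul]
    linear_combination h1

theorem extDFun_update_smul {q : ℕ} (α : Form A q) (v : Fin (q + 1) → VF A) (i : Fin (q + 1))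
    (f : A) (x : VF A) :
    extDFun α (Function.update v i (f • x)) = f • extDFun α (Function.update v i x) := by
  have key (y : VF A) : extDFun α (Function.update v i y) =
      (-1 : ℤ) ^ (i : ℕ) • extDFun α (Matrix.vecCons y (i.removeNth v)) := by
    rw [← Fin.insertNth_removeNth, extDFun_eq, AlternatingMap.map_insertNth]
  rw [key, key, extDFun_cons_smul, smul_comm]

/-- The de Rham differential `d : Ω^q → Ω^{q+1}`. -/
def extD {q : ℕ} : Form A q →ₗ[ℝ] Form A (q + 1) where
  toFun α :=
    { toFun := extDFun α
      map_update_add' := fun {inst} v i x y => by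
        rw [extDFun_eq]; exact AlternatingMap.map_update_add _ v i x y
      map_update_smul' := fun {inst} v i f x => by
        rw [Subsingleton.elim inst (instDecidableEqFin _)]
        exact extDFun_update_smul α v i f x
      map_eq_zero_of_eq' := fun v i j h hij => by
        rw [extDFun_eq]; exact AlternatingMap.map_eq_zero_of_eq _ v h hij }
  map_add' α β := by
    ext v
    change extDFun (α + β) v = extDFun α v + extDFun β v
    have h : derivComp (α + β) = derivComp α + derivComp β := by
      ext x u; exact map_add x (α u) (β u)
    have h' : ceDiff (α + β).toReal v = ceDiff α.toReal v + ceDiff β.toReal v := by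
      cases q with
      | zero => exact (add_zero _).symm
      | succ q =>
        change -_ = -_ + -_
        simp only [← neg_add, ← Finset.sum_add_distrib, ← smul_add]
        rfl
    rw [extDFun_eq, extDFun_eq, extDFun_eq, h, AlternatingMap.alternatizeUncurryFin_add]
    simp only [AlternatingMap.add_apply, h']
    abel
  map_smul' c α := by
    ext v
    change extDFun (c • α) v = c • extDFun α v
    have h : derivComp (c • α) = c • derivComp α := by
      ext x u; exact x.map_smul c (α u)
    have h' : ceDiff (c • α).toReal v = c • ceDiff α.toReal v := by
      cases q with
      | zero => exact (smul_zero _).symm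
      | succ q =>
        change -_ = c • -_
        simp only [smul_neg, Finset.smul_sum]
        congr 1
        refine Finset.sum_congr rfl fun i _ => Finset.sum_congr rfl fun j _ => ?_
        rw [smul_comm c]
        rfl
    rw [extDFun_eq, extDFun_eq, h, AlternatingMap.alternatizeUncurryFin_smul]
    simp only [AlternatingMap.add_apply, AlternatingMap.smul_apply, h', smul_add]

/-- The Lie derivative, evaluated on vector fields:
`(L_v α)(w_1, …, w_q) = v(α(w_1, …, w_q)) - ∑_j α(w_1, …, [v, w_j], …, w_q)`. -/
def lieDerivFun {q : ℕ} (v : VF A) (α : Form A q) (w : Fin q → VF A) : A :=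
  v (α w) - ∑ j : Fin q, α (Function.update w j ⁅v, w j⁆)

theorem lieDerivFun_update {q : ℕ} (v : VF A) (α : Form A q) (w : Fin q → VF A) (i : Fin q)
    (x : VF A) : lieDerivFun v α (Function.update w i x) =
      v (α (Function.update w i x)) - α (Function.update w i ⁅v, x⁆) -
        ∑ j ∈ Finset.univ.erase i,
          α (Function.update (Function.update w j ⁅v, w j⁆) i x) := by
  rw [lieDerivFun, ← Finset.add_sum_erase _ _ (Finset.mem_univ i), ← sub_sub]
  congr 1
  · simp
  · refine Finset.sum_congr rfl fun j hj => ?_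
    have hji : j ≠ i := Finset.ne_of_mem_erase hj
    rw [Function.update_of_ne hji, Function.update_comm hji]

/-- The Lie derivative `L_v : Ω^q → Ω^q`. -/
def lieDeriv {q : ℕ} (v : VF A) (α : Form A q) : Form A q where
  toFun := lieDerivFun v α
  map_update_add' := fun {inst} w i x y => by
    rw [Subsingleton.elim inst (instDecidableEqFin _)]
    simp only [lieDerivFun_update, AlternatingMap.map_update_add, lie_add, map_add,
      Finset.sum_add_distrib]
    abel
  map_update_smul' := fun {inst} w i f x => by
    rw [Subsingleton.elim inst (instDecidableEqFin _)]
    have hlie : ⁅v, f • x⁆ = f • ⁅v, x⁆ + (v f) • x := by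
      ext a
      simp [Derivation.commutator_apply]
    simp only [lieDerivFun_update, AlternatingMap.map_update_add, AlternatingMap.map_update_smul,
      hlie, smul_eq_mul, Derivation.leibniz, ← Finset.mul_sum]
    ring
  map_eq_zero_of_eq' := fun w i j h hij => by
    have hz : ∀ k, k ≠ i → k ≠ j → α (Function.update w k ⁅v, w k⁆) = 0 := fun k hi hj =>
      α.map_eq_zero_of_eq _ (by
        rw [Function.update_of_ne hi.symm, Function.update_of_ne hj.symm, h]) hij
    have hs : ∑ k : Fin q, α (Function.update w k ⁅v, w k⁆) =
        α (Function.update w i ⁅v, w i⁆) + α (Function.update w j ⁅v, w j⁆) :=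
      Fintype.sum_eq_add i j hij fun k hk => hz k hk.1 hk.2
    have hswap : Function.update w j ⁅v, w j⁆ =
        Function.update w i ⁅v, w i⁆ ∘ Equiv.swap i j := by
      funext k
      by_cases hki : k = i
      · subst hki
        simp [hij, h, hij.symm]
      · by_cases hkj : k = j
        · subst hkj
          simp [h]
        · simp [hki, hkj, Equiv.swap_apply_of_ne_of_ne]
    rw [lieDerivFun, hs, hswap, α.map_swap _ hij, α.map_eq_zero_of_eq w h hij]
    simp

/-! ### The graded vector space of all forms -/

variable (A) in
/-- `Ω^•(X)`: a form for every degree.  Homogeneous elements have a single nonzero component. -/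
abbrev Omega := ∀ q : ℕ, Form A q

variable (A) in
/-- The inclusion `Ω^q(X) → Ω^•(X)`. -/
def incl (q : ℕ) : Form A q →ₗ[ℝ] Omega A := LinearMap.single ℝ (Form A) q

/-- The de Rham differential on `Ω^•(X)`. -/
def dTot : Omega A →ₗ[ℝ] Omega A where
  toFun α
    | 0 => 0
    | q + 1 => extD (α q)
  map_add' α β := by
    funext q
    cases q with
    | zero => exact (add_zero _).symm
    | succ q => exact map_add extD (α q) (β q)
  map_smul' c α := by
    funext q
    cases q with
    | zero => exact (smul_zero c).symm
    | succ q => exact map_smul extD c (α q)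

/-- The interior product `ι_v` on `Ω^•(X)`: `(ι_v α)(w_1, …, w_q) = α(v, w_1, …, w_q)`. -/
def iota (v : VF A) (α : Omega A) : Omega A := fun q => (α (q + 1)).curryLeft v

/-- The iterated interior product `ι_{χ_k} ⋯ ι_{χ_1} α`. -/
def iotaIter : {k : ℕ} → (Fin k → VF A) → Omega A → Omega A
  | 0, _, α => α
  | _ + 1, χ, α => iotaIter (Fin.tail χ) (iota (χ 0) α)

/-- Auxiliary concatenation `(χ_1, …, χ_k, w_1, …, w_q)`. -/
def cat {k q : ℕ} (χ : Fin k → VF A) (w : Fin q → VF A) : Fin (q + k) → VF A :=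
  fun m => if h : (m : ℕ) < k then χ ⟨m, h⟩ else w ⟨m - k, by omega⟩

theorem iotaIter_apply {k : ℕ} (χ : Fin k → VF A) (α : Omega A) (q : ℕ) (w : Fin q → VF A) :
    iotaIter χ α q w = α (q + k) (cat χ w) := by
  induction k generalizing α with
  | zero => rfl
  | succ k ih =>
    rw [iotaIter, ih]
    have h : (Matrix.vecCons (χ 0) (cat (Fin.tail χ) w) : Fin (q + k + 1) → VF A) =
        (cat χ w : Fin (q + (k + 1)) → VF A) := by
      funext m
      cases m using Fin.cases with
      | zero => simp [cat]
      | succ m => simp [cat, Fin.tail]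
    exact congrArg (α (q + k + 1)) h

theorem cat_update {k q : ℕ} (χ : Fin k → VF A) (w : Fin q → VF A) (i : Fin k) (x : VF A) :
    cat (Function.update χ i x) w =
      Function.update (cat χ w) ⟨i, by omega⟩ x := by
  funext m
  by_cases hm : m = ⟨i, by omega⟩
  · subst hm
    simp [cat]
  · rw [Function.update_of_ne hm]
    unfold cat
    split_ifs with h
    · rw [Function.update_of_ne]
      intro h'
      exact hm (Fin.ext (Fin.ext_iff.1 h' :))
    · rfl

end Forms

section Action

variable {A : Type*} [CommRing A] [Algebra ℝ A]
variable {𝔤 : Type*} [LieRing 𝔤] [LieAlgebra ℝ 𝔤]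

/-- For `β ∈ Ω^•(X)`, the element `a_1 ∧ ⋯ ∧ a_p ↦ ι_{ρ(a_p)} ⋯ ι_{ρ(a_1)} β` of
`Hom(Λ^p 𝔤, Ω^q(X))`; it sees the component of `β` of degree `p + q`. -/
def contraction (ρ : 𝔤 →ₗ⁅ℝ⁆ VF A) (β : Omega A) (p q : ℕ) : 𝔤 [⋀^Fin p]→ₗ[ℝ] Form A q where
  toFun a := iotaIter (fun j => ρ (a j)) β q
  map_update_add' := fun {inst} a i x y => by
    obtain rfl : inst = instDecidableEqFin _ := Subsingleton.elim _ _
    have h (z : 𝔤) : (fun j => ρ (Function.update a i z j)) =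
        Function.update (fun j => ρ (a j)) i (ρ z) := by
      funext j; exact Function.apply_update (fun _ => ρ) a i z j
    ext w
    rw [AlternatingMap.add_apply]
    simp only [iotaIter_apply, h, cat_update, map_add, AlternatingMap.map_update_add]
  map_update_smul' := fun {inst} a i c x => by
    obtain rfl : inst = instDecidableEqFin _ := Subsingleton.elim _ _
    have h (z : 𝔤) : (fun j => ρ (Function.update a i z j)) =
        Function.update (fun j => ρ (a j)) i (ρ z) := by
      funext j; exact Function.apply_update (fun _ => ρ) a i z j
    ext w
    rw [AlternatingMap.smul_apply]
    simp only [iotaIter_apply, h, cat_update, map_smul]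
    exact (β (q + p)).toReal.map_update_smul _ _ c _
  map_eq_zero_of_eq' := fun a i j h hij => by
    ext w
    rw [iotaIter_apply]
    refine (β (q + p)).map_eq_zero_of_eq _ (i := ⟨i, by omega⟩) (j := ⟨j, by omega⟩) ?_ ?_
    · simp [cat, h]
    · intro h'
      exact hij (Fin.ext (Fin.ext_iff.1 h' :))

/-! ### The double complex `Ω^{p,q}(𝔤, X) = Hom(Λ^p 𝔤, Ω^q(X))` -/

variable (𝔤 A) in
/-- Families of elements of `Hom(Λ^p 𝔤, Ω^q(X))`, for all `p` and `q`. -/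
abbrev BiForm := ∀ p q : ℕ, 𝔤 [⋀^Fin p]→ₗ[ℝ] Form A q

variable (𝔤 A) in
/-- `Ω^N(𝔤, X) = ⨁_{p ≥ 1, q ≥ 0, p + q = N} Ω^{p,q}(𝔤, X)`. -/
def totalDegree (N : ℕ) : Submodule ℝ (BiForm A 𝔤) where
  carrier := {α | ∀ p q, ¬ (1 ≤ p ∧ p + q = N) → α p q = 0}
  add_mem' {α β} hα hβ p q h := by
    change α p q + β p q = 0
    rw [hα p q h, hβ p q h, add_zero]
  zero_mem' p q _ := rfl
  smul_mem' c α hα p q h := by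
    change c • α p q = 0
    rw [hα p q h, smul_zero]

/-- `d_𝔤 α = α ∘ δ_CE`. -/
def dLie (α : BiForm A 𝔤) : BiForm A 𝔤
  | 0, _ => 0
  | p + 1, q => ceDiff (α p q)

/-- `d_X α = (-1)^p d ∘ α` on `Ω^{p,•}(𝔤, X)`. -/
def dX (α : BiForm A 𝔤) : BiForm A 𝔤
  | _, 0 => 0
  | p, q + 1 => (-1 : ℝ) ^ p • extD.compAlternatingMap (α p q)

/-- The differential `d_𝔤 + d_X` of the total complex. -/
def dBar (α : BiForm A 𝔤) : BiForm A 𝔤 := dLie α + dX α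

/-- `β̄ = ∑_{i ≥ 1} (-1)^{i-1} β_i`, where `β_i` is the contraction of `β` with `i` generators. -/
def bar (ρ : 𝔤 →ₗ⁅ℝ⁆ VF A) {m : ℕ} (β : Form A m) : BiForm A 𝔤 := fun p q =>
  if 1 ≤ p then (-1 : ℝ) ^ (p - 1) • contraction ρ (incl A m β) p q else 0

theorem bar_mem_totalDegree (ρ : 𝔤 →ₗ⁅ℝ⁆ VF A) {m : ℕ} (β : Form A m) :
    bar ρ β ∈ totalDegree A 𝔤 m := by
  intro p q h
  by_cases hp : 1 ≤ p
  · have hm : q + p ≠ m := fun h' => h ⟨hp, by omega⟩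
    have h0 : contraction ρ (incl A m β) p q = 0 := by
      ext a w
      change iotaIter (fun j => ρ (a j)) (incl A m β) q w = 0
      rw [iotaIter_apply]
      have : incl A m β (q + p) = 0 := Pi.single_eq_of_ne hm β
      rw [this]; rfl
    rw [bar, if_pos hp, h0, smul_zero]
  · rw [bar, if_neg hp]

/-! ### `L_∞`-algebras and morphisms out of a Lie algebra -/

/-- A `ℤ`-grading and multibrackets on a vector space.  The brackets are only meaningful on
homogeneous elements. -/
structure GradedBrackets (L : Type*) [AddCommGroup L] [Module ℝ L] where
  /-- The homogeneous part of a given degree. -/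
  part : ℤ → Submodule ℝ L
  /-- The multibracket `l_k`. -/
  bracket : (k : ℕ) → (Fin k → L) → L

/-- `L_∞`-morphisms from a Lie algebra `𝔤` (in degree `0`, with its Lie bracket as the only bracket)
to a graded vector space with multibrackets `l_k` of degree `2 - k`: skew-symmetric multilinear maps
`f_i : Λ^i 𝔤 → L` of degree `1 - i`, for `i ≥ 1`, such that for all `m ≥ 1`
`∑_{i<j} (-1)^{i+j+1} f_{m-1}([a_i, a_j], ‥ â_i ‥ â_j ‥) =`
`∑_k ∑_{c_1 + ⋯ + c_k = m} ± 1 / (k! c_1! ⋯ c_k!) ∑_σ sgn(σ) l_k(f_{c_1}(a_{σ(1)}, …), …, f_{c_k}(…, a_{σ(m)}))`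
with sign `(-1)^{∑_j (k - j) (c_j - 1)}`, the Koszul sign of the arguments `f_{c_j}(…)`. -/
structure IsLInftyMorphism {L : Type*} [AddCommGroup L] [Module ℝ L] (B : GradedBrackets L)
    (f : ∀ i : ℕ, 𝔤 [⋀^Fin i]→ₗ[ℝ] L) : Prop where
  zero : f 0 = 0
  degree : ∀ i : ℕ, 1 ≤ i → ∀ a, f i a ∈ B.part (1 - (i : ℤ))
  relation : ∀ (r : ℕ) (a : Fin (r + 1) → 𝔤),
    -ceDiff (f r) a = ∑ c : Composition (r + 1),
      ((-1 : ℝ) ^ (∑ j : Fin c.length, (c.length - 1 - (j : ℕ)) * (c.blocksFun j - 1)) /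
        ((c.length.factorial : ℝ) * ∏ j, ((c.blocksFun j).factorial : ℝ))) •
      ∑ σ : Equiv.Perm (Fin (r + 1)), (Equiv.Perm.sign σ : ℤ) •
        B.bracket c.length (fun j => f (c.blocksFun j) (fun t => a (σ (c.embedding j t))))

/-! ### Premultisymplectic geometry -/

/-- `χ` is a Hamiltonian vector field of `α`: `ι_χ ω = -dα`. -/
def IsHamVF {n : ℕ} (ω₀ : Form A (n + 1)) (α : Omega A) (χ : VF A) : Prop :=
  iota χ (incl A (n + 1) ω₀) = -dTot α

open Classical in
/-- A choice of Hamiltonian vector field, if there is one. -/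
def hamVF {n : ℕ} (ω₀ : Form A (n + 1)) (α : Omega A) : VF A :=
  if h : ∃ χ, IsHamVF ω₀ α χ then h.choose else 0

/-- The degree `i` part of `L_∞(X, ω)`: Hamiltonian `(n-1)`-forms for `i = 0`, all forms of degree
`n - 1 + i` for `1 - n ≤ i < 0`, and zero otherwise. -/
def LInftyPart {n : ℕ} (ω₀ : Form A (n + 1)) (i : ℤ) : Submodule ℝ (Omega A) where
  carrier := {α | (∀ q : ℕ, ¬ (i ≤ 0 ∧ (q : ℤ) = n - 1 + i) → α q = 0) ∧
    (i = 0 → ∃ χ, IsHamVF ω₀ α χ)}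
  add_mem' {α β} hα hβ := by
    refine ⟨fun q h => ?_, fun h => ?_⟩
    · change α q + β q = 0
      rw [hα.1 q h, hβ.1 q h, add_zero]
    · obtain ⟨χ, hχ⟩ := hα.2 h
      obtain ⟨ξ, hξ⟩ := hβ.2 h
      refine ⟨χ + ξ, ?_⟩
      unfold IsHamVF at *
      rw [map_add, neg_add, ← hχ, ← hξ]
      funext q
      exact map_add _ χ ξ
  zero_mem' := by
    refine ⟨fun q _ => rfl, fun _ => ⟨0, ?_⟩⟩
    unfold IsHamVF
    rw [map_zero, neg_zero]
    funext q
    exact map_zero _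
  smul_mem' c α hα := by
    refine ⟨fun q h => ?_, fun h => ?_⟩
    · change c • α q = 0
      rw [hα.1 q h, smul_zero]
    · obtain ⟨χ, hχ⟩ := hα.2 h
      refine ⟨c • χ, ?_⟩
      unfold IsHamVF at *
      have h2 : iota (c • χ) (incl A (n + 1) ω₀) = c • iota χ (incl A (n + 1) ω₀) := by
        funext q
        ext w
        exact AlternatingMap.map_vecCons_smul (incl A (n + 1) ω₀ (q + 1)).toReal w c χ
      rw [h2, hχ, map_smul]
      exact smul_neg c _

open Classical in
/-- The multibrackets of `L_∞(X, ω)`: `l_1 = d` in negative degrees (that is, on `q`-forms with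
`q < n - 1`), `l_k(α_1, …, α_k) = -(-1)^{k(k+1)/2} ι_{χ_k} ⋯ ι_{χ_1} ω` for `k > 1` and Hamiltonian
forms `α_i` with Hamiltonian vector fields `χ_i`, and `l_k = 0` in all other cases. -/
def LInftyBracket {n : ℕ} (ω₀ : Form A (n + 1)) : (k : ℕ) → (Fin k → Omega A) → Omega A
  | 0, _ => 0
  | 1, α => dTot (fun q => if q + 1 < n then α 0 q else 0)
  | k + 2, α =>
      if ∀ j, α j ∈ LInftyPart ω₀ 0 then
        (-(-1 : ℝ) ^ ((k + 2) * (k + 3) / 2)) •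
          iotaIter (fun j => hamVF ω₀ (α j)) (incl A (n + 1) ω₀)
      else 0

/-- The `L_∞`-algebra `L_∞(X, ω)` of Hamiltonian forms. -/
def LInfty {n : ℕ} (ω₀ : Form A (n + 1)) : GradedBrackets (Omega A) where
  part := LInftyPart ω₀
  bracket := LInftyBracket ω₀

/-- The infinitesimal action `ρ` leaves `ω` invariant. -/
def IsPremultisymplectic {m : ℕ} (ω₀ : Form A m) (ρ : 𝔤 →ₗ⁅ℝ⁆ VF A) : Prop :=
  ∀ a, lieDeriv (ρ a) ω₀ = 0

/-- `μ` consists of the components `μ_i : Λ^i 𝔤 → L_∞(X, ω)` of a homotopy momentum map for the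
premultisymplectic action `ρ`: an `L_∞`-morphism with `ι_{ρ(a)} ω = -d μ_1(a)`. -/
structure IsHomotopyMomentumMap {n : ℕ} (ω₀ : Form A (n + 1)) (ρ : 𝔤 →ₗ⁅ℝ⁆ VF A)
    (μ : ∀ i : ℕ, 𝔤 [⋀^Fin i]→ₗ[ℝ] Omega A) : Prop where
  premultisymplectic : IsPremultisymplectic ω₀ ρ
  morphism : IsLInftyMorphism (LInfty ω₀) μ
  hamiltonian : ∀ a : 𝔤, iota (ρ a) (incl A (n + 1) ω₀) = -dTot (μ 1 (fun _ => a))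

/-- The action admits a homotopy momentum map. -/
def IsHamiltonian {n : ℕ} (ω₀ : Form A (n + 1)) (ρ : 𝔤 →ₗ⁅ℝ⁆ VF A) : Prop :=
  ∃ μ, IsHomotopyMomentumMap ω₀ ρ μ

end Action

end Multisymp

end

/-! Everything rests on the extended Cartan formula `dTot_contractionTot`: up to signs, `d ι_{a_p} ⋯
ι_{a_1} β` is the sum of the contraction of `dβ`, the contractions of the Lie derivatives `L_{a_i}
β` with `a_i` omitted, and `β_{p-1} ∘ δ_CE`. If `ω` is closed and invariant, only the last term
survives, so `ω_{p-1} ∘ δ_CE = (-1)^p d ω_p`, and the components of `d̄ ω̄` cancel in pairs.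
Conversely, the lowest component of `d̄ ω̄` is `-d ι_{ρ(a)} ω`, which for closed `ω` equals
`-L_{ρ(a)} ω`. This is (i).

For (ii), a component `f_c` with `c ≥ 2` takes values in negative degree, where all brackets `l_k`
with `k ≥ 2` vanish. In the relation for `m ≥ 2` arguments only two compositions of `m` therefore
contribute: the single block, giving `d f_m`, and the all-ones composition, giving a multiple of
`ω_m` because `ρ(a)` is a Hamiltonian vector field of `f_1(a)` (`sum_lInftyTerm`). For `m = 1` the
same formula is the condition `ι_{ρ(a)} ω = -d f_1(a)`. After the rescaling by `-(-1)^{i(i+1)/2}`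
these equations are exactly the components of `d̄ ν = ω̄` (`relation_iff`). Invariance of `ω` then
comes for free: `L_{ρ(a)} ω = d ι_{ρ(a)} ω = -d d ν_1(a) = 0`. -/

namespace Multisymp

/-! ### Cartan's formula for the Chevalley–Eilenberg differential. -/

section ChevalleyEilenberg

variable {𝔤 : Type*} [LieRing 𝔤] [LieAlgebra ℝ 𝔤] {V : Type*} [AddCommGroup V] [Module ℝ V]

theorem removeNth_succ_vecCons {M : Type*} {r : ℕ} (y : M) (u : Fin (r + 1) → M)
    (i : Fin (r + 1)) :
    i.succ.removeNth (Matrix.vecCons y u : Fin (r + 2) → M) =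
      Matrix.vecCons y (i.removeNth u) := by
  funext k
  cases k using Fin.cases <;> simp [Fin.removeNth_apply]

theorem removeNth_zero_vecCons {M : Type*} {r : ℕ} (y : M) (u : Fin r → M) :
    (0 : Fin (r + 1)).removeNth (Matrix.vecCons y u : Fin (r + 1) → M) = u := rfl

theorem map_update_eq_vecCons_removeNth {R M N : Type*} [CommRing R] [AddCommGroup M] [Module R M]
    [AddCommGroup N] [Module R N] {k : ℕ} (α : M [⋀^Fin (k + 1)]→ₗ[R] N)
    (w : Fin (k + 1) → M) (j : Fin (k + 1)) (y : M) :
    α (Function.update w j y) = (-1 : ℤ) ^ (j : ℕ) • α (Matrix.vecCons y (j.removeNth w)) := by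
  rw [← Fin.insertNth_removeNth, AlternatingMap.map_insertNth]

theorem map_vecCons_swap {R M N : Type*} [CommRing R] [AddCommGroup M] [Module R M]
    [AddCommGroup N] [Module R N] {k : ℕ} (α : M [⋀^Fin (k + 2)]→ₗ[R] N)
    (x y : M) (w : Fin k → M) :
    α (Matrix.vecCons x (Matrix.vecCons y w)) = -α (Matrix.vecCons y (Matrix.vecCons x w)) := by
  rw [← α.map_swap _ (Fin.zero_ne_one : (0 : Fin (k + 2)) ≠ 1)]
  congr 1
  funext i
  refine Fin.cases ?_ (fun i => Fin.cases ?_ (fun i => ?_) i) i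
  · simp
  · simp
  · rw [Function.comp_apply, Equiv.swap_apply_of_ne_of_ne]
    · rfl
    · exact Fin.succ_ne_zero _
    · exact fun h => Fin.succ_ne_zero _ (Fin.succ_injective _ h)

theorem sum_Ici_succ {M : Type*} [AddCommMonoid M] {k : ℕ} (i : Fin k) (f : Fin (k + 1) → M) :
    ∑ j ∈ Finset.Ici i.succ, f j = ∑ j ∈ Finset.Ici i, f j.succ := by
  rw [← Fin.map_succEmb_Ici, Finset.sum_map]
  rfl

/-- Cartan's formula for the Chevalley–Eilenberg differential with trivial coefficients. -/
theorem ceDiff_vecCons {k : ℕ} (α : 𝔤 [⋀^Fin (k + 1)]→ₗ[ℝ] V) (x : 𝔤) (w : Fin (k + 1) → 𝔤) :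
    ceDiff α (Matrix.vecCons x w) =
      -ceDiff (α.curryLeft x) w - ∑ j, α (Function.update w j ⁅x, w j⁆) := by
  change -_ = _
  -- The pairs containing `x` form the summand `i = 0` and give the bracket terms. In all others `x`
  -- stands right behind the bracket; moving it to the front costs one sign, while shifting both
  -- indices by one costs none.
  rw [Fin.sum_univ_succ, neg_add, add_comm, sub_eq_add_neg]
  congr 1
  · congr 1
    cases k with
    | zero => rfl
    | succ k =>
      change _ = -_
      rw [← Finset.sum_neg_distrib]
      refine Finset.sum_congr rfl fun i _ => ?_
      rw [sum_Ici_succ, ← Finset.sum_neg_distrib]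
      refine Finset.sum_congr rfl fun j _ => ?_
      rw [Fin.castSucc_succ, removeNth_succ_vecCons, removeNth_succ_vecCons, map_vecCons_swap,
        AlternatingMap.curryLeft_apply_apply, smul_neg]
      congr 2
      simp only [Fin.val_succ]
      ring
  · congr 1
    rw [show Finset.Ici (0 : Fin (k + 1)) = Finset.univ by ext; simp]
    refine Finset.sum_congr rfl fun j _ => ?_
    rw [map_update_eq_vecCons_removeNth, Fin.castSucc_zero, removeNth_zero_vecCons, Fin.val_zero,
      zero_add]
    rfl

theorem ceDiff_compAlternatingMap {W : Type*} [AddCommGroup W] [Module ℝ W] {k : ℕ}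
    (g : V →ₗ[ℝ] W) (α : 𝔤 [⋀^Fin k]→ₗ[ℝ] V) :
    ceDiff (g.compAlternatingMap α) = g.compAlternatingMap (ceDiff α) := by
  ext a
  cases k with
  | zero => exact (map_zero g).symm
  | succ k =>
    change -_ = g (-_)
    simp only [map_neg, map_sum, map_zsmul]
    rfl

theorem ceDiff_smul {k : ℕ} (c : ℝ) (α : 𝔤 [⋀^Fin k]→ₗ[ℝ] V) : ceDiff (c • α) = c • ceDiff α :=
  ceDiff_compAlternatingMap (LinearMap.lsmul ℝ V c) α

theorem ceDiff_fin_zero (α : 𝔤 [⋀^Fin 0]→ₗ[ℝ] V) : ceDiff α = 0 := rfl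

end ChevalleyEilenberg

/-! ### Cartan calculus on the space of all forms. -/

section Cartan

variable {A : Type*} [CommRing A] [Algebra ℝ A]

/-- The part of `d` without brackets contributes `v (α w)`, its other terms cancelling; the bracket
part is `ceDiff_vecCons` for the Lie algebra of vector fields. -/
theorem extD_curryLeft_add {q : ℕ} (v : VF A) (α : Form A (q + 1)) :
    extD (α.curryLeft v) + (extD α).curryLeft v = lieDeriv v α := by
  ext w
  have h := ceDiff_vecCons α.toReal v w
  change extDFun (α.curryLeft v) w + extDFun α (Matrix.vecCons v w) = lieDerivFun v α w
  have h1 : ceDiff (α.toReal.curryLeft v) = ceDiff (Form.toReal (α.curryLeft v)) := rfl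
  have h2 (u : Fin (q + 1) → VF A) : α.toReal u = α u := rfl
  have h3 : ∑ i : Fin (q + 2), (-1 : ℤ) ^ (i : ℕ) • (Matrix.vecCons v w : Fin (q + 2) → VF A) i
      (α (i.removeNth (Matrix.vecCons v w : Fin (q + 2) → VF A))) =
      v (α w) - ∑ i : Fin (q + 1), (-1 : ℤ) ^ (i : ℕ) • w i (α.curryLeft v (i.removeNth w)) := by
    rw [Fin.sum_univ_succ, sub_eq_add_neg, ← Finset.sum_neg_distrib]
    congr 1
    · rw [Fin.val_zero, pow_zero, one_smul, removeNth_zero_vecCons, Matrix.cons_val_zero]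
    · refine Finset.sum_congr rfl fun i _ => ?_
      rw [removeNth_succ_vecCons, Fin.val_succ, pow_succ, mul_neg_one, neg_smul]
      rfl
  rw [extDFun, extDFun, h, h3, lieDerivFun, h1]
  simp only [h2]
  abel

/-- The interior product as a linear operator on `Ω^•(X)`. -/
def iotaL (v : VF A) : Omega A →ₗ[ℝ] Omega A where
  toFun := iota v
  map_add' _ _ := rfl
  map_smul' _ _ := rfl

theorem iotaL_apply (v : VF A) (α : Omega A) : iotaL v α = iota v α := rfl

theorem iotaL_add (v w : VF A) : iotaL (v + w) = iotaL v + iotaL w := by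
  ext α : 1
  funext q
  exact map_add (α (q + 1)).curryLeft v w

theorem iotaL_neg (v : VF A) : iotaL (-v) = -iotaL v := by
  ext α : 1
  funext q
  exact map_neg (α (q + 1)).curryLeft v

theorem iotaL_swap (v w : VF A) (α : Omega A) :
    iotaL v (iotaL w α) = -iotaL w (iotaL v α) := by
  funext q
  ext u
  exact map_vecCons_swap (α (q + 2)) w v u

/-- The Lie derivative `L_v = d ι_v + ι_v d` as a linear operator on `Ω^•(X)`. -/
def lieTot (v : VF A) : Omega A →ₗ[ℝ] Omega A := dTot ∘ₗ iotaL v + iotaL v ∘ₗ dTot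

theorem lieTot_apply (v : VF A) (α : Omega A) :
    lieTot v α = dTot (iotaL v α) + iotaL v (dTot α) := rfl

theorem lieTot_apply_apply (v : VF A) (α : Omega A) (q : ℕ) :
    lieTot v α q = lieDeriv v (α q) := by
  cases q with
  | zero =>
    ext w
    change (0 : A) + extDFun (α 0) (Matrix.vecCons v w) = lieDerivFun v (α 0) w
    simp [extDFun, lieDerivFun, ceDiff_fin_zero]
  | succ q => exact extD_curryLeft_add v (α (q + 1))

theorem lieTot_iotaL (v w : VF A) (α : Omega A) :
    lieTot v (iotaL w α) = iotaL w (lieTot v α) + iotaL ⁅v, w⁆ α := by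
  funext q
  rw [lieTot_apply_apply, Pi.add_apply]
  change _ = (lieTot v α (q + 1)).curryLeft w + (α (q + 1)).curryLeft ⁅v, w⁆
  rw [lieTot_apply_apply]
  ext u
  change v (α (q + 1) (Matrix.vecCons w u)) -
      ∑ j, α (q + 1) (Matrix.vecCons w (Function.update u j ⁅v, u j⁆)) =
    v (α (q + 1) (Matrix.vecCons w u)) - ∑ j : Fin (q + 1), α (q + 1)
      (Function.update (Matrix.vecCons w u) j ⁅v, (Matrix.vecCons w u : Fin (q + 1) → VF A) j⁆) +
    α (q + 1) (Matrix.vecCons ⁅v, w⁆ u)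
  rw [Fin.sum_univ_succ]
  have h0 : Function.update (Matrix.vecCons w u : Fin (q + 1) → VF A) 0 ⁅v, w⁆ =
      Matrix.vecCons ⁅v, w⁆ u := Fin.update_cons_zero _ _ _
  have h1 (j : Fin q) : Function.update (Matrix.vecCons w u : Fin (q + 1) → VF A) j.succ
      ⁅v, u j⁆ = Matrix.vecCons w (Function.update u j ⁅v, u j⁆) :=
    (Fin.cons_update _ _ _ _).symm
  simp only [Matrix.cons_val_zero, Matrix.cons_val_succ, h0, h1]
  abel

/-- A form of positive degree is determined by its contractions, so induction on the degree applies.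
The remaining Cartan identities follow by taking for `T` the difference of the two sides. -/
theorem eq_zero_of_iotaL_comm (T : Omega A →ₗ[ℝ] Omega A) (c : ℤ) (h0 : ∀ α, T α 0 = 0)
    (h : ∀ v α, iotaL v (T α) = c • T (iotaL v α)) : T = 0 := by
  suffices H : ∀ q α, T α q = 0 from LinearMap.ext fun α => funext fun q => H q α
  intro q
  induction q with
  | zero => exact h0
  | succ q ih =>
    intro α
    ext w
    have := DFunLike.congr_fun (congrFun (h (w 0) α) q) (Fin.tail w)
    rw [Pi.smul_apply, ih, smul_zero] at this
    have hw : Matrix.vecCons (w 0) (Fin.tail w) = w := Fin.cons_self_tail w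
    change T α (q + 1) (Matrix.vecCons (w 0) (Fin.tail w)) = 0 at this
    rwa [hw] at this

theorem iotaL_lieTot (v w : VF A) (α : Omega A) :
    iotaL w (lieTot v α) = lieTot v (iotaL w α) - iotaL ⁅v, w⁆ α := by
  rw [lieTot_iotaL, add_sub_cancel_right]

theorem iotaL_dTot (v : VF A) (α : Omega A) :
    iotaL v (dTot α) = lieTot v α - dTot (iotaL v α) := by
  rw [lieTot_apply, add_sub_cancel_left]

theorem lieTot_lieTot (v w : VF A) (α : Omega A) :
    lieTot v (lieTot w α) - lieTot w (lieTot v α) = lieTot ⁅v, w⁆ α := by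
  have h := eq_zero_of_iotaL_comm
    (lieTot v ∘ₗ lieTot w - lieTot w ∘ₗ lieTot v - lieTot ⁅v, w⁆) 1 ?_ ?_
  · have := LinearMap.congr_fun h α
    exact sub_eq_zero.1 this
  · intro α
    change lieTot v (lieTot w α) 0 - lieTot w (lieTot v α) 0 - lieTot ⁅v, w⁆ α 0 = 0
    simp only [lieTot_apply_apply]
    ext u
    change lieDerivFun _ _ u - lieDerivFun _ _ u - lieDerivFun _ _ u = 0
    simp only [lieDerivFun, Finset.univ_eq_empty, Finset.sum_empty, sub_zero]
    change v (lieDerivFun w (α 0) u) - w (lieDerivFun v (α 0) u) - _ = 0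
    simp [lieDerivFun, Derivation.commutator_apply]
  · intro u α
    simp only [LinearMap.sub_apply, LinearMap.comp_apply, map_sub, iotaL_lieTot, one_smul]
    -- The contractions with iterated brackets cancel by the Jacobi identity.
    rw [leibniz_lie v w u, iotaL_add, LinearMap.add_apply]
    abel

theorem lieTot_dTot (v : VF A) (α : Omega A) : lieTot v (dTot α) = dTot (lieTot v α) := by
  have h := eq_zero_of_iotaL_comm (lieTot v ∘ₗ dTot - dTot ∘ₗ lieTot v) (-1) ?_ ?_
  · exact sub_eq_zero.1 (LinearMap.congr_fun h α)
  · intro α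
    change lieTot v (dTot α) 0 - 0 = 0
    rw [lieTot_apply_apply, sub_zero]
    change lieDeriv v 0 = 0
    ext u
    simp [lieDeriv, lieDerivFun]
  · intro w α
    simp only [LinearMap.sub_apply, LinearMap.comp_apply, map_sub, iotaL_lieTot, iotaL_dTot,
      ← lieTot_lieTot v w]
    abel

theorem dTot_dTot (α : Omega A) : dTot (dTot α) = 0 := by
  have h := eq_zero_of_iotaL_comm (A := A) (dTot ∘ₗ dTot) 1 (fun α => rfl) ?_
  · exact LinearMap.congr_fun h α
  · intro w α
    simp only [LinearMap.comp_apply, map_sub, iotaL_dTot, lieTot_dTot, one_smul]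
    abel

theorem dTot_incl {q : ℕ} (α : Form A q) : dTot (incl A q α) = incl A (q + 1) (extD α) := by
  funext r
  cases r with
  | zero => exact (Pi.single_eq_of_ne (M := Form A) (Nat.succ_ne_zero q).symm (extD α)).symm
  | succ r =>
    change extD (Pi.single (M := Form A) q α r) =
      Pi.single (M := Form A) (q + 1) (extD α) (r + 1)
    by_cases h : r = q
    · subst h
      simp
    · rw [Pi.single_eq_of_ne h, Pi.single_eq_of_ne (by omega), map_zero]

theorem lieTot_incl {q : ℕ} (v : VF A) (α : Form A q) :
    lieTot v (incl A q α) = incl A q (lieDeriv v α) := by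
  funext r
  rw [lieTot_apply_apply]
  change lieDeriv v (Pi.single (M := Form A) q α r) =
    Pi.single (M := Form A) q (lieDeriv v α) r
  by_cases h : r = q
  · subst h
    simp
  · rw [Pi.single_eq_of_ne h, Pi.single_eq_of_ne h]
    ext u
    simp [lieDeriv, lieDerivFun]

end Cartan

/-! ### Iterated contractions and the extended Cartan formula. -/

section IteratedContraction

variable {A : Type*} [CommRing A] [Algebra ℝ A]
variable {𝔤 : Type*} [LieRing 𝔤] [LieAlgebra ℝ 𝔤]

/-- The alternating map `a_1 ∧ ⋯ ∧ a_p ↦ ι_{ρ(a_p)} ⋯ ι_{ρ(a_1)} β` with values in `Ω^•(X)`. -/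
def contractionTot (ρ : 𝔤 →ₗ⁅ℝ⁆ VF A) (β : Omega A) (p : ℕ) : 𝔤 [⋀^Fin p]→ₗ[ℝ] Omega A :=
  AlternatingMap.pi (contraction ρ β p)

theorem contractionTot_apply (ρ : 𝔤 →ₗ⁅ℝ⁆ VF A) (β : Omega A) {p : ℕ} (a : Fin p → 𝔤) :
    contractionTot ρ β p a = iotaIter (fun j => ρ (a j)) β := rfl

/-- The first argument is contracted innermost, so inductions on `p` replace `β` by `ι_{ρ(x)} β`. -/
theorem contractionTot_vecCons (ρ : 𝔤 →ₗ⁅ℝ⁆ VF A) (β : Omega A) {p : ℕ} (x : 𝔤)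
    (a : Fin p → 𝔤) : contractionTot ρ β (p + 1) (Matrix.vecCons x a) =
      contractionTot ρ (iotaL (ρ x) β) p a := rfl

theorem contractionTot_curryLeft (ρ : 𝔤 →ₗ⁅ℝ⁆ VF A) (β : Omega A) (p : ℕ) (x : 𝔤) :
    (contractionTot ρ β (p + 1)).curryLeft x = contractionTot ρ (iotaL (ρ x) β) p := rfl

theorem contractionTot_one (ρ : 𝔤 →ₗ⁅ℝ⁆ VF A) (β : Omega A) (a : Fin 1 → 𝔤) :
    contractionTot ρ β 1 a = iotaL (ρ (a 0)) β := rfl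

/-- The iterated interior product as a linear operator on `Ω^•(X)`. -/
def iotaIterL {k : ℕ} (χ : Fin k → VF A) : Omega A →ₗ[ℝ] Omega A where
  toFun := iotaIter χ
  map_add' α β := by
    funext q
    ext w
    rw [iotaIter_apply, Pi.add_apply, Pi.add_apply, AlternatingMap.add_apply,
      AlternatingMap.add_apply, iotaIter_apply, iotaIter_apply]
  map_smul' c α := by
    funext q
    ext w
    change _ = c • iotaIter χ α q w
    rw [iotaIter_apply, iotaIter_apply]
    rfl

theorem contractionTot_add (ρ : 𝔤 →ₗ⁅ℝ⁆ VF A) (α β : Omega A) {p : ℕ} (a : Fin p → 𝔤) :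
    contractionTot ρ (α + β) p a = contractionTot ρ α p a + contractionTot ρ β p a :=
  map_add (iotaIterL _) α β

theorem contractionTot_sub (ρ : 𝔤 →ₗ⁅ℝ⁆ VF A) (α β : Omega A) {p : ℕ} (a : Fin p → 𝔤) :
    contractionTot ρ (α - β) p a = contractionTot ρ α p a - contractionTot ρ β p a :=
  map_sub (iotaIterL _) α β

theorem contractionTot_neg (ρ : 𝔤 →ₗ⁅ℝ⁆ VF A) (β : Omega A) {p : ℕ} (a : Fin p → 𝔤) :
    contractionTot ρ (-β) p a = -contractionTot ρ β p a :=
  map_neg (iotaIterL _) β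

theorem contractionTot_zero (ρ : 𝔤 →ₗ⁅ℝ⁆ VF A) (p : ℕ) :
    contractionTot ρ (0 : Omega A) p = 0 :=
  AlternatingMap.ext fun _ => map_zero (iotaIterL _)

/-- Contractions anticommute, so each `χ j` can be brought next to `α`. Hence the brackets of
`L_∞(X, ω)` do not depend on the choice of Hamiltonian vector fields, even when `ω` is degenerate.
-/
theorem iotaIter_congr {k : ℕ} (χ ξ : Fin k → VF A) (α : Omega A)
    (h : ∀ j, iotaL (χ j) α = iotaL (ξ j) α) : iotaIter χ α = iotaIter ξ α := by
  induction k generalizing α with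
  | zero => rfl
  | succ k ih =>
    change iotaIter (Fin.tail χ) (iotaL (χ 0) α) = iotaIter (Fin.tail ξ) (iotaL (ξ 0) α)
    rw [h 0]
    refine ih _ _ _ fun j => ?_
    rw [iotaL_swap, iotaL_swap (Fin.tail ξ j)]
    exact congrArg (fun β => -iotaL (ξ 0) β) (h j.succ)

theorem iotaIter_eq_zero {k : ℕ} (χ : Fin k → VF A) (α : Omega A) (j : Fin k)
    (h : iotaL (χ j) α = 0) : iotaIter χ α = 0 := by
  induction k generalizing α with
  | zero => exact j.elim0
  | succ k ih =>
    change iotaIter (Fin.tail χ) (iotaL (χ 0) α) = 0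
    cases j using Fin.cases with
    | zero =>
      rw [h]
      exact map_zero (iotaIterL _)
    | succ j =>
      refine ih _ _ j ?_
      rw [iotaL_swap, show iotaL (Fin.tail χ j) α = 0 from h, map_zero, neg_zero]

/-- The extended Cartan formula for `d ι_{ρ(a_p)} ⋯ ι_{ρ(a_1)} β`. -/
theorem dTot_contractionTot (ρ : 𝔤 →ₗ⁅ℝ⁆ VF A) (β : Omega A) {k : ℕ} (a : Fin (k + 1) → 𝔤) :
    dTot (contractionTot ρ β (k + 1) a) =
      (-1 : ℤ) ^ (k + 1) • contractionTot ρ (dTot β) (k + 1) a +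
      ∑ i : Fin (k + 1), (-1 : ℤ) ^ (k + i) •
        contractionTot ρ (lieTot (ρ (a i)) β) k (i.removeNth a) +
      (-1 : ℤ) ^ (k + 1) • ceDiff (contractionTot ρ β k) a := by
  induction k generalizing β with
  | zero =>
    rw [Fin.sum_univ_one, contractionTot_one, contractionTot_one, iotaL_dTot, ceDiff_fin_zero]
    simp [contractionTot_apply, iotaIter]
  | succ k ih =>
    -- The induction hypothesis is applied to `ι_{ρ(x)} β` and the arguments `b`. Commuting
    -- `L_{ρ(b_i)}` past `ι_{ρ(x)}` (`h2`) produces contractions with `[b_i, x]`, which are the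
    -- bracket terms that `ceDiff_vecCons` demands.
    obtain ⟨x, b, rfl⟩ : ∃ x b, a = Matrix.vecCons x b :=
      ⟨a 0, Fin.tail a, (Fin.cons_self_tail a).symm⟩
    rw [contractionTot_vecCons, ih, Fin.sum_univ_succ (n := k + 1), ceDiff_vecCons, contractionTot_curryLeft]
    have h1 : dTot (iotaL (ρ x) β) = lieTot (ρ x) β - iotaL (ρ x) (dTot β) := by
      rw [lieTot_apply, add_sub_cancel_right]
    have h2 (i : Fin (k + 1)) : (-1 : ℤ) ^ (k + i : ℕ) •
        contractionTot ρ (lieTot (ρ (b i)) (iotaL (ρ x) β)) k (i.removeNth b) =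
        (-1 : ℤ) ^ (k + 1 + i.succ : ℕ) • contractionTot ρ (lieTot (ρ (b i)) β) (k + 1)
          (i.succ.removeNth (Matrix.vecCons x b)) +
        (-1 : ℤ) ^ (k + 1) • contractionTot ρ β (k + 1) (Function.update b i ⁅x, b i⁆) := by
      rw [lieTot_iotaL, contractionTot_add, smul_add, removeNth_succ_vecCons,
        contractionTot_vecCons, map_update_eq_vecCons_removeNth, contractionTot_vecCons,
        ← lie_skew, iotaL_neg, LinearMap.neg_apply, contractionTot_neg, LieHom.map_lie, smul_neg,
        smul_smul, ← neg_smul, Fin.val_succ]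
      congr 2 <;> ring
    have h3 : -contractionTot ρ (iotaL (ρ x) (dTot β)) (k + 1) b =
        -contractionTot ρ (dTot β) (k + 2) (Matrix.vecCons x b) := rfl
    simp only [h1, h2, contractionTot_sub, Finset.sum_add_distrib, ← Finset.smul_sum,
      Matrix.cons_val_zero, removeNth_zero_vecCons, Fin.val_zero, add_zero, Matrix.cons_val_succ,
      contractionTot_vecCons, pow_succ _ (k + 1), mul_neg_one, neg_smul, smul_sub, smul_neg]
    abel

theorem ceDiff_contractionTot (ρ : 𝔤 →ₗ⁅ℝ⁆ VF A) (β : Omega A) (hd : dTot β = 0)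
    (hL : ∀ a, lieTot (ρ a) β = 0) {k : ℕ} (a : Fin (k + 1) → 𝔤) :
    ceDiff (contractionTot ρ β k) a =
      (-1 : ℤ) ^ (k + 1) • dTot (contractionTot ρ β (k + 1) a) := by
  simp [dTot_contractionTot, hd, hL, contractionTot_zero, smul_smul, ← mul_pow]

end IteratedContraction

/-! ### The total complex and part (i). -/

section TotalComplex

variable {A : Type*} [CommRing A] [Algebra ℝ A]
variable {𝔤 : Type*} [LieRing 𝔤] [LieAlgebra ℝ 𝔤]

theorem omega_neg_smul (c : ℝ) (α : Omega A) : (-c) • α = -(c • α) := neg_smul c α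

theorem omega_neg_one_smul (α : Omega A) : (-1 : ℝ) • α = -α := neg_one_smul ℝ α

theorem dX_apply (α : BiForm A 𝔤) (p q : ℕ) (a : Fin p → 𝔤) :
    dX α p q a = ((-1 : ℝ) ^ p • dTot (AlternatingMap.pi (α p) a)) q := by
  cases q with
  | zero => exact (smul_zero ((-1 : ℝ) ^ p) : (-1 : ℝ) ^ p • (0 : Form A 0) = 0).symm
  | succ q => rfl

theorem dBar_succ_apply (α : BiForm A 𝔤) (p q : ℕ) (a : Fin (p + 1) → 𝔤) :
    dBar α (p + 1) q a = (ceDiff (AlternatingMap.pi (α p)) a +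
      (-1 : ℝ) ^ (p + 1) • dTot (AlternatingMap.pi (α (p + 1)) a)) q := by
  change ceDiff (α p q) a + dX α (p + 1) q a = _
  rw [dX_apply, Pi.add_apply]
  congr 1
  exact DFunLike.congr_fun (ceDiff_compAlternatingMap (LinearMap.proj q)
    (AlternatingMap.pi (α p) : 𝔤 [⋀^Fin p]→ₗ[ℝ] Omega A)) a

/-- Collecting all form degrees `q` into one `Ω^•(X)`-valued map turns an equation in the double
complex into one equation for each number of arguments, without case distinctions on `q`. -/
theorem dBar_eq_iff {α β : BiForm A 𝔤} (hα : α 0 = 0) (hβ : β 0 = 0) :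
    dBar α = β ↔ ∀ (r : ℕ) (a : Fin (r + 1) → 𝔤), ceDiff (AlternatingMap.pi (α r)) a +
      (-1 : ℝ) ^ (r + 1) • dTot (AlternatingMap.pi (α (r + 1)) a) =
        AlternatingMap.pi (β (r + 1)) a := by
  constructor
  · rintro rfl r a
    funext q
    exact (dBar_succ_apply α r q a).symm
  · intro h
    funext p q
    cases p with
    | zero =>
      rw [hβ]
      ext a : 1
      change 0 + dX α 0 q a = 0
      rw [dX_apply, hα, zero_add]
      have : (AlternatingMap.pi (0 : ∀ q, 𝔤 [⋀^Fin 0]→ₗ[ℝ] Form A q) a : Omega A) = 0 := rfl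
      rw [this, map_zero, smul_zero]
      rfl
    | succ p =>
      ext a : 1
      rw [dBar_succ_apply, h]
      rfl

theorem bar_zero (ρ : 𝔤 →ₗ⁅ℝ⁆ VF A) {m : ℕ} (β : Form A m) : bar ρ β 0 = 0 := rfl

theorem pi_bar_succ (ρ : 𝔤 →ₗ⁅ℝ⁆ VF A) {m : ℕ} (β : Form A m) (r : ℕ) :
    AlternatingMap.pi (bar ρ β (r + 1)) =
      (-1 : ℝ) ^ r • contractionTot ρ (incl A m β) (r + 1) := rfl

theorem isPremultisymplectic_iff_lieTot {m : ℕ} (ω₀ : Form A m) (ρ : 𝔤 →ₗ⁅ℝ⁆ VF A) :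
    IsPremultisymplectic ω₀ ρ ↔ ∀ a, lieTot (ρ a) (incl A m ω₀) = 0 := by
  refine forall_congr' fun a => ?_
  rw [lieTot_incl]
  constructor
  · intro h
    rw [h, map_zero]
  · intro h
    exact Pi.single_injective (M := Form A) m (h.trans (map_zero (incl A m)).symm)

theorem isPremultisymplectic_iff_dBar {m : ℕ} (ω₀ : Form A m) (hω : extD ω₀ = 0)
    (ρ : 𝔤 →ₗ⁅ℝ⁆ VF A) : IsPremultisymplectic ω₀ ρ ↔ dBar (bar ρ ω₀) = 0 := by
  have hd : dTot (incl A m ω₀) = 0 := by rw [dTot_incl, hω, map_zero]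
  rw [isPremultisymplectic_iff_lieTot, dBar_eq_iff (bar_zero ρ ω₀) rfl]
  constructor
  · intro hL r a
    change _ = (0 : Omega A)
    cases r with
    -- The component with one argument is `-d ι_{ρ(a)} ω`, which is `-L_{ρ(a)} ω` as `ω` is closed;
    -- the converse below uses this component alone.
    | zero =>
      have := hL (a 0)
      rw [lieTot_apply, hd, map_zero, add_zero] at this
      rw [ceDiff_fin_zero, pi_bar_succ, pow_zero, one_smul, contractionTot_one, this, smul_zero]
      exact add_zero _
    | succ r =>
      rw [pi_bar_succ, pi_bar_succ, ceDiff_smul, AlternatingMap.smul_apply,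
        AlternatingMap.smul_apply, ceDiff_contractionTot ρ _ hd hL]
      rcases Nat.even_or_odd r with hr | hr <;> simp [pow_succ, hr.neg_one_pow, omega_neg_one_smul]
  · intro h a
    have := h 0 fun _ => a
    rw [ceDiff_fin_zero, pi_bar_succ, pow_zero, one_smul, contractionTot_one] at this
    rw [lieTot_apply, hd, map_zero, add_zero]
    have h1 : (0 : Omega A) + (-1 : ℝ) ^ (0 + 1) • dTot (iotaL (ρ a) (incl A m ω₀)) = 0 := this
    simpa using h1

end TotalComplex

/-! ### The relations of an `L_∞`-morphism into `L_∞(X, ω)`. -/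

noncomputable section HomotopyMomentumMap

variable {A : Type*} [CommRing A] [Algebra ℝ A]
variable {𝔤 : Type*} [LieRing 𝔤] [LieAlgebra ℝ 𝔤]
variable {n : ℕ} (ω₀ : Form A (n + 1))

theorem isHamVF_hamVF {α : Omega A} (h : α ∈ LInftyPart ω₀ 0) :
    IsHamVF ω₀ α (hamVF ω₀ α) := by
  rw [hamVF, dif_pos (h.2 rfl)]
  exact (h.2 rfl).choose_spec

/-- Parts of different degree consist of forms of different form degree, so they meet only in zero.
-/
theorem eq_zero_of_mem_LInftyPart {α : Omega A} {i : ℤ} (hi : i ≠ 0)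
    (h : α ∈ LInftyPart ω₀ i) (h0 : α ∈ LInftyPart ω₀ 0) : α = 0 := by
  funext q
  by_cases hq : (q : ℤ) = n - 1 + i
  · exact h0.1 q fun h' => by omega
  · exact h.1 q fun h' => hq h'.2

theorem LInftyBracket_eq_zero {k : ℕ} (hk : 2 ≤ k) (α : Fin k → Omega A) (j : Fin k) {i : ℤ}
    (hi : i ≠ 0) (h : α j ∈ LInftyPart ω₀ i) : LInftyBracket ω₀ k α = 0 := by
  obtain ⟨k, rfl⟩ := Nat.exists_eq_add_of_le' hk
  rw [LInftyBracket]
  split_ifs with h0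
  -- The zero form also lies in degree `0`, so the bracket may be given by the contraction formula.
  -- The vector field chosen for it need not vanish, but it lies in the kernel of `ω`.
  · have hj : α j = 0 := eq_zero_of_mem_LInftyPart ω₀ hi h (h0 j)
    have := isHamVF_hamVF ω₀ (h0 j)
    rw [IsHamVF, hj, map_zero, neg_zero] at this
    rw [iotaIter_eq_zero _ _ j (by rw [hj]; exact this), smul_zero]
  · rfl

theorem LInftyBracket_of_isHamVF {k : ℕ} (hk : 2 ≤ k) (α : Fin k → Omega A) (χ : Fin k → VF A)
    (h : ∀ j, α j ∈ LInftyPart ω₀ 0) (hχ : ∀ j, IsHamVF ω₀ (α j) (χ j)) :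
    LInftyBracket ω₀ k α =
      (-(-1 : ℝ) ^ (k * (k + 1) / 2)) • iotaIter χ (incl A (n + 1) ω₀) := by
  obtain ⟨k, rfl⟩ := Nat.exists_eq_add_of_le' hk
  rw [LInftyBracket, if_pos h]
  congr 1
  exact iotaIter_congr _ _ _ fun j => (isHamVF_hamVF ω₀ (h j)).trans (hχ j).symm

/-- In negative degrees the truncation in `l_1` removes nothing. The arity is only propositionally
`1`, since it will be the length of a composition. -/
theorem LInftyBracket_one_of_neg {k : ℕ} (hk : k = 1) (α : Fin k → Omega A) (j : Fin k) {i : ℤ}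
    (hi : i < 0) (h : α j ∈ LInftyPart ω₀ i) : LInftyBracket ω₀ k α = dTot (α j) := by
  subst hk
  obtain rfl := Subsingleton.elim j 0
  rw [LInftyBracket]
  congr 1
  funext q
  split_ifs with hq
  · rfl
  · exact (h.1 q fun h' => by omega).symm

theorem LInftyBracket_one_of_zero {k : ℕ} (hk : k = 1) (α : Fin k → Omega A) (j : Fin k)
    (h : α j ∈ LInftyPart ω₀ 0) : LInftyBracket ω₀ k α = 0 := by
  subst hk
  obtain rfl := Subsingleton.elim j 0
  rw [LInftyBracket, ← map_zero dTot]
  congr 1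
  funext q
  split_ifs with hq
  · exact h.1 q fun h' => by omega
  · rfl

theorem iotaIter_cast {k l : ℕ} (h : k = l) (χ : Fin l → VF A) (β : Omega A) :
    iotaIter (fun j : Fin k => χ (Fin.cast h j)) β = iotaIter χ β := by
  subst h
  rfl

theorem apply_of_eq_one {M V : Type*} [AddCommGroup M] [Module ℝ M] [AddCommGroup V] [Module ℝ V]
    (f : ∀ i : ℕ, M [⋀^Fin i]→ₗ[ℝ] V) {m : ℕ} (hm : m = 1) (u : Fin m → M) (t : Fin m) :
    f m u = f 1 fun _ => u t := by
  subst hm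
  congr 1
  funext s
  rw [Subsingleton.elim s t]

/-- This factorial cancels the denominator in the morphism relation: `c_1!` for the single block,
`k!` for the all-ones composition. -/
theorem sum_sign_smul_map_perm {M V : Type*} [AddCommGroup M] [Module ℝ M] [AddCommGroup V]
    [Module ℝ V] {r : ℕ} (F : M [⋀^Fin r]→ₗ[ℝ] V) (a : Fin r → M) :
    ∑ σ : Equiv.Perm (Fin r), (Equiv.Perm.sign σ : ℤ) • F (fun j => a (σ j)) =
      (r.factorial : ℝ) • F a := by
  have h (σ : Equiv.Perm (Fin r)) : (Equiv.Perm.sign σ : ℤ) • F (fun j => a (σ j)) = F a := by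
    have := F.map_perm a σ
    rw [show (fun j => a (σ j)) = a ∘ σ from rfl, this, Units.smul_def, smul_smul,
      Int.units_coe_mul_self, one_smul]
  simp only [h, Finset.sum_const, Finset.card_univ, Fintype.card_perm, Fintype.card_fin]
  rw [Nat.cast_smul_eq_nsmul]

variable (ρ : 𝔤 →ₗ⁅ℝ⁆ VF A) (f : ∀ i : ℕ, 𝔤 [⋀^Fin i]→ₗ[ℝ] Omega A)

/-- The summand of the relations of an `L_∞`-morphism `𝔤 → L_∞(X, ω)` for a composition `c`. -/
def lInftyTerm {m : ℕ} (a : Fin m → 𝔤) (c : Composition m) : Omega A :=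
  ((-1 : ℝ) ^ (∑ j : Fin c.length, (c.length - 1 - (j : ℕ)) * (c.blocksFun j - 1)) /
    ((c.length.factorial : ℝ) * ∏ j, ((c.blocksFun j).factorial : ℝ))) •
  ∑ σ : Equiv.Perm (Fin m), (Equiv.Perm.sign σ : ℤ) •
    LInftyBracket ω₀ c.length
      (fun j => f (c.blocksFun j) (fun t => a (σ (c.embedding j t))))

variable {f}

/-- Some block has size at least `2`, so it feeds an element of negative degree into a bracket of
arity at least `2`. -/
theorem lInftyTerm_eq_zero (hf : ∀ i : ℕ, 1 ≤ i → ∀ a, f i a ∈ LInftyPart ω₀ (1 - (i : ℤ)))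
    {m : ℕ} (a : Fin m → 𝔤) (c : Composition m) (h1 : 2 ≤ c.length) (h2 : c ≠ Composition.ones m) :
    lInftyTerm ω₀ f a c = 0 := by
  obtain ⟨b, hb, hb1⟩ := Composition.ne_ones_iff.1 h2
  obtain ⟨j, rfl⟩ : ∃ j, c.blocksFun j = b := by
    obtain ⟨j, hj⟩ := List.mem_iff_get.1 hb
    exact ⟨j, hj⟩
  rw [lInftyTerm]
  refine (congrArg _ (Finset.sum_eq_zero fun σ _ => ?_)).trans (smul_zero _)
  rw [LInftyBracket_eq_zero ω₀ h1 _ j (i := 1 - (c.blocksFun j : ℤ)) (by omega)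
    (hf _ (by omega) _), smul_zero]

theorem lInftyTerm_single (hf : ∀ i : ℕ, 1 ≤ i → ∀ a, f i a ∈ LInftyPart ω₀ (1 - (i : ℤ)))
    {r : ℕ} (hr : 1 ≤ r) (a : Fin (r + 1) → 𝔤) :
    lInftyTerm ω₀ f a (Composition.single (r + 1) r.succ_pos) = dTot (f (r + 1) a) := by
  have h (σ : Equiv.Perm (Fin (r + 1))) :
      LInftyBracket ω₀ (Composition.single (r + 1) r.succ_pos).length
        (fun j => f ((Composition.single (r + 1) r.succ_pos).blocksFun j)
          (fun t => a (σ ((Composition.single (r + 1) r.succ_pos).embedding j t)))) =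
      (dTot.compAlternatingMap (f (r + 1))) (fun j => a (σ j)) := by
    rw [LInftyBracket_one_of_neg ω₀ (Composition.single_length _) _ ⟨0, Nat.one_pos⟩
      (i := 1 - ((r + 1 : ℕ) : ℤ)) (by push_cast; omega) (hf _ (by omega) _)]
    rw [LinearMap.compAlternatingMap_apply]
    congr 2
    funext t
    congr 2
    exact Composition.single_embedding r.succ_pos t
  rw [lInftyTerm]
  simp only [h]
  rw [sum_sign_smul_map_perm, smul_smul, LinearMap.compAlternatingMap_apply]
  have h1 : (((r + 1).factorial : ℕ) : ℝ) ≠ 0 := by positivity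
  have h2 : ∏ j, (((Composition.single (r + 1) r.succ_pos).blocksFun j).factorial : ℝ) =
      ((r + 1).factorial : ℝ) :=
    Fin.prod_univ_one fun j =>
      (((Composition.single (r + 1) r.succ_pos).blocksFun j).factorial : ℝ)
  rw [h2]
  simp [h1]

theorem lInftyTerm_ones (hf : ∀ i : ℕ, 1 ≤ i → ∀ a, f i a ∈ LInftyPart ω₀ (1 - (i : ℤ)))
    (ham : ∀ a, iota (ρ a) (incl A (n + 1) ω₀) = -dTot (f 1 fun _ => a))
    {m : ℕ} (hm : 2 ≤ m) (a : Fin m → 𝔤) :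
    lInftyTerm ω₀ f a (Composition.ones m) =
      (-(-1 : ℝ) ^ (m * (m + 1) / 2)) • contractionTot ρ (incl A (n + 1) ω₀) m a := by
  have h (σ : Equiv.Perm (Fin m)) :
      LInftyBracket ω₀ (Composition.ones m).length
        (fun j => f ((Composition.ones m).blocksFun j)
          (fun t => a (σ ((Composition.ones m).embedding j t)))) =
      ((-(-1 : ℝ) ^ (m * (m + 1) / 2)) • contractionTot ρ (incl A (n + 1) ω₀) m)
        (fun j => a (σ j)) := by
    have hval (j : Fin (Composition.ones m).length) :
        f ((Composition.ones m).blocksFun j)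
          (fun t => a (σ ((Composition.ones m).embedding j t))) =
        f 1 (fun _ => a (σ (Fin.cast (Composition.ones_length m) j))) := by
      have hpos : 0 < (Composition.ones m).blocksFun j := by simp
      rw [apply_of_eq_one f (Composition.ones_blocksFun m j) _ ⟨0, hpos⟩,
        Composition.ones_embedding j hpos]
      rfl
    simp only [hval]
    rw [LInftyBracket_of_isHamVF ω₀ (by simpa using hm) _
      (fun j => ρ (a (σ (Fin.cast (Composition.ones_length m) j))))
      (fun j => by simpa using hf 1 le_rfl _) (fun j => ham _),
      iotaIter_cast (Composition.ones_length m) (fun j => ρ (a (σ j))), Composition.ones_length]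
    rfl
  rw [lInftyTerm]
  simp only [h]
  rw [sum_sign_smul_map_perm, smul_smul, AlternatingMap.smul_apply]
  have h1 : ((m.factorial : ℕ) : ℝ) ≠ 0 := by positivity
  simp [h1, omega_neg_smul]

theorem sum_lInftyTerm (hf : ∀ i : ℕ, 1 ≤ i → ∀ a, f i a ∈ LInftyPart ω₀ (1 - (i : ℤ)))
    (ham : ∀ a, iota (ρ a) (incl A (n + 1) ω₀) = -dTot (f 1 fun _ => a))
    (r : ℕ) (a : Fin (r + 1) → 𝔤) :
    ∑ c : Composition (r + 1), lInftyTerm ω₀ f a c = dTot (f (r + 1) a) +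
      (-(-1 : ℝ) ^ ((r + 1) * (r + 2) / 2)) •
        contractionTot ρ (incl A (n + 1) ω₀) (r + 1) a := by
  -- For one argument the single block and the all-ones composition coincide. The left side is then
  -- `l_1` of a degree `0` element, hence zero, and the right side vanishes by `ham`.
  rcases Nat.eq_zero_or_pos r with rfl | hr
  · have h0 : contractionTot ρ (incl A (n + 1) ω₀) (0 + 1) a = -dTot (f (0 + 1) a) := by
      rw [contractionTot_one, iotaL_apply, ham]
      congr 3
      funext j
      rw [Subsingleton.elim j 0]
    rw [h0]
    simp only [zero_add, one_mul, Nat.div_self zero_lt_two, pow_one, neg_neg, one_smul,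
      add_neg_cancel]
    refine Finset.sum_eq_zero fun c _ => ?_
    have hl : c.length = 1 := le_antisymm c.length_le (c.length_pos_of_pos zero_lt_one)
    rw [lInftyTerm]
    refine (congrArg _ (Finset.sum_eq_zero fun σ _ => ?_)).trans (smul_zero _)
    have hb : c.blocksFun ⟨0, by omega⟩ = 1 :=
      le_antisymm (c.blocksFun_le _) (c.one_le_blocksFun _)
    rw [LInftyBracket_one_of_zero ω₀ hl _ ⟨0, by omega⟩, smul_zero]
    rw [apply_of_eq_one f hb _ ⟨0, by omega⟩]
    simpa using hf 1 le_rfl _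
  · rw [Fintype.sum_eq_add (Composition.single (r + 1) r.succ_pos) (Composition.ones (r + 1)),
      lInftyTerm_single ω₀ hf hr, lInftyTerm_ones ω₀ ρ hf ham (by omega)]
    · intro h
      have := congrArg Composition.length h
      rw [Composition.single_length, Composition.ones_length] at this
      omega
    · intro c hc
      refine lInftyTerm_eq_zero ω₀ hf a c ?_ hc.2
      have h1 := c.length_pos_of_pos r.succ_pos
      have h2 : c.length ≠ 1 := fun h => hc.1 ((Composition.eq_single_iff_length _).2 h)
      omega

end HomotopyMomentumMap

/-! ### Matching signs, and part (ii). -/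

section MainTheorem

variable {A : Type*} [CommRing A] [Algebra ℝ A]
variable {𝔤 : Type*} [LieRing 𝔤] [LieAlgebra ℝ 𝔤]
variable {n : ℕ} (ω₀ : Form A (n + 1)) (ρ : 𝔤 →ₗ⁅ℝ⁆ VF A)

theorem neg_one_pow_triangular_succ (r : ℕ) :
    (-1 : ℝ) ^ ((r + 1) * (r + 2) / 2) = (-1) ^ (r * (r + 1) / 2) * (-1) ^ (r + 1) := by
  rw [← pow_add, show (r + 1) * (r + 2) = r * (r + 1) + (r + 1) * 2 by ring,
    Nat.add_mul_div_right _ _ zero_lt_two]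

/-- Here `e` is the sign `(-1)^{r(r+1)/2}` and `s = (-1)^{r+1}`, so that `e * s` is the next
triangular sign; dividing by `e` leaves the sign pattern of the total differential. -/
theorem smul_relation_iff {M : Type*} [AddCommGroup M] [Module ℝ M] {e s : ℝ} (he : e ≠ 0)
    (x y z : M) :
    -((-e) • x) = (-(e * s)) • y + (-(e * s)) • z ↔ x + s • y = (-s) • z := by
  constructor <;> intro h
  · refine smul_right_injective M he ?_
    linear_combination (norm := module) h
  · linear_combination (norm := module) e • h

/-- The relations of an `L_∞`-morphism with components `-(-1)^{i(i+1)/2} F_i`, in terms of the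
total differential. -/
theorem relation_iff {F : ∀ i : ℕ, 𝔤 [⋀^Fin i]→ₗ[ℝ] Omega A}
    (hf : ∀ i : ℕ, 1 ≤ i → ∀ a,
      ((-(-1 : ℝ) ^ (i * (i + 1) / 2)) • F i) a ∈ LInftyPart ω₀ (1 - (i : ℤ)))
    (ham : ∀ a, iota (ρ a) (incl A (n + 1) ω₀) = -dTot (F 1 fun _ => a))
    (r : ℕ) (a : Fin (r + 1) → 𝔤) :
    -ceDiff ((-(-1 : ℝ) ^ (r * (r + 1) / 2)) • F r) a =
        ∑ c : Composition (r + 1),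
          lInftyTerm ω₀ (fun i => (-(-1 : ℝ) ^ (i * (i + 1) / 2)) • F i) a c ↔
      ceDiff (F r) a + (-1 : ℝ) ^ (r + 1) • dTot (F (r + 1) a) =
        (-1 : ℝ) ^ r • contractionTot ρ (incl A (n + 1) ω₀) (r + 1) a := by
  rw [sum_lInftyTerm ω₀ ρ hf fun a => ?_]
  · rw [ceDiff_smul, AlternatingMap.smul_apply, AlternatingMap.smul_apply, map_smul,
      neg_one_pow_triangular_succ]
    have h := smul_relation_iff (e := (-1 : ℝ) ^ (r * (r + 1) / 2)) (s := (-1) ^ (r + 1))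
      (pow_ne_zero _ (by norm_num)) (ceDiff (F r) a) (dTot (F (r + 1) a))
      (contractionTot ρ (incl A (n + 1) ω₀) (r + 1) a)
    rwa [show -(-1 : ℝ) ^ (r + 1) = (-1) ^ r by rw [pow_succ]; ring] at h
  · rw [ham]
    simp

/-- In total degree `n` the row `ν i` is concentrated in form degree `n - i`. For `i > n` the
truncated difference is `0`, which is harmless since the whole row is zero. -/
theorem incl_compAlternatingMap_eq_pi {ν : BiForm A 𝔤} (hν : ν ∈ totalDegree A 𝔤 n) (i : ℕ) :
    (incl A (n - i)).compAlternatingMap (ν i (n - i)) = AlternatingMap.pi (ν i) := by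
  ext a : 1
  funext q
  change Pi.single (M := Form A) (n - i) (ν i (n - i) a) q = ν i q a
  by_cases h : q = n - i
  · subst h
    simp
  · rw [Pi.single_eq_of_ne h, hν i q (by omega)]
    rfl

theorem isHomotopyMomentumMap_of_dBar_eq (hω : extD ω₀ = 0) {ν : BiForm A 𝔤}
    (hν : ν ∈ totalDegree A 𝔤 n) (h : dBar ν = bar ρ ω₀) :
    IsHomotopyMomentumMap ω₀ ρ (fun i => (-(-1 : ℝ) ^ (i * (i + 1) / 2)) •
      (incl A (n - i)).compAlternatingMap (ν i (n - i))) := by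
  simp only [incl_compAlternatingMap_eq_pi hν]
  have hν0 : ν 0 = 0 := funext fun q => hν 0 q (by omega)
  rw [dBar_eq_iff hν0 (bar_zero ρ ω₀)] at h
  have ham (a : 𝔤) : iota (ρ a) (incl A (n + 1) ω₀) =
      -dTot (AlternatingMap.pi (ν 1) fun _ => a) := by
    have h1 := h 0 fun _ => a
    rw [ceDiff_fin_zero, pi_bar_succ, pow_zero, one_smul, contractionTot_one, zero_add,
      pow_one] at h1
    rw [← iotaL_apply, ← h1, ← omega_neg_one_smul]
    exact zero_add _
  have hd : dTot (incl A (n + 1) ω₀) = 0 := by rw [dTot_incl, hω, map_zero]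
  have hf (i : ℕ) (hi : 1 ≤ i) (a : Fin i → 𝔤) :
      ((-(-1 : ℝ) ^ (i * (i + 1) / 2)) • (AlternatingMap.pi (ν i) : 𝔤 [⋀^Fin i]→ₗ[ℝ] Omega A)) a ∈
        LInftyPart ω₀ (1 - (i : ℤ)) := by
    rw [AlternatingMap.smul_apply]
    refine Submodule.smul_mem _ _ ⟨fun q hq => ?_, fun h0 => ?_⟩
    · change ν i q a = 0
      rw [hν i q (by omega)]
      rfl
    -- Only the first component has degree `0`, and `ρ(a)` itself is its Hamiltonian vector field.
    · obtain rfl : i = 1 := by omega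
      refine ⟨ρ (a 0), ?_⟩
      rw [IsHamVF, ham]
      congr 3
      funext j
      rw [Subsingleton.elim j 0]
  refine ⟨?_, ⟨?_, hf, fun r a => ?_⟩, fun a => ?_⟩
  · rw [isPremultisymplectic_iff_lieTot]
    intro a
    rw [lieTot_apply, hd, map_zero, add_zero, iotaL_apply, ham, map_neg, dTot_dTot, neg_zero]
  · simp only [hν0]
    ext a : 1
    exact smul_zero (A := Omega A) _
  · refine (relation_iff ω₀ ρ hf ham r a).2 ?_
    rw [h r a, pi_bar_succ]
    rfl
  · rw [ham]
    simp

theorem exists_dBar_eq_of_isHomotopyMomentumMap {μ : ∀ i : ℕ, 𝔤 [⋀^Fin i]→ₗ[ℝ] Omega A}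
    (hμ : IsHomotopyMomentumMap ω₀ ρ μ) :
    ∃ ν ∈ totalDegree A 𝔤 n, dBar ν = bar ρ ω₀ := by
  classical
  -- The rescaling sign is its own inverse (`hsq`), so the same factor recovers `ν` from `μ`.
  -- Nothing is lost by cutting down to total degree `n`, because the degree condition puts the
  -- values of `μ p` in form degree `n - p`, or makes them zero if `p > n`.
  let ν : BiForm A 𝔤 := fun p q => if 1 ≤ p ∧ p + q = n then
    (-(-1 : ℝ) ^ (p * (p + 1) / 2)) •
      (LinearMap.proj (φ := Form A) q : Omega A →ₗ[ℝ] Form A q).compAlternatingMap (μ p) else 0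
  have hν : ν ∈ totalDegree A 𝔤 n := fun p q h => if_neg h
  have hsq (p : ℕ) : (-(-1 : ℝ) ^ (p * (p + 1) / 2)) * -(-1 : ℝ) ^ (p * (p + 1) / 2) = 1 := by
    rw [neg_mul_neg, ← mul_pow]
    simp
  have hpi (p : ℕ) : μ p = (-(-1 : ℝ) ^ (p * (p + 1) / 2)) •
      (AlternatingMap.pi (ν p) : 𝔤 [⋀^Fin p]→ₗ[ℝ] Omega A) := by
    ext a : 1
    funext q
    change μ p a q = (-(-1 : ℝ) ^ (p * (p + 1) / 2)) • ν p q a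
    by_cases h : 1 ≤ p ∧ p + q = n
    · simp only [ν, if_pos h]
      rw [AlternatingMap.smul_apply, smul_smul, hsq, one_smul]
      rfl
    · simp only [ν, if_neg h]
      rw [AlternatingMap.zero_apply, smul_zero]
      rcases Nat.eq_zero_or_pos p with rfl | hp
      · rw [hμ.morphism.zero]
        rfl
      · exact (hμ.morphism.degree p hp a).1 q (by omega)
  refine ⟨ν, hν, ?_⟩
  rw [dBar_eq_iff (funext fun q => hν 0 q (by omega)) (bar_zero ρ ω₀)]
  intro r a
  have hμ' : μ = fun p => (-(-1 : ℝ) ^ (p * (p + 1) / 2)) •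
    (AlternatingMap.pi (ν p) : 𝔤 [⋀^Fin p]→ₗ[ℝ] Omega A) := funext hpi
  rw [hμ'] at hμ
  have h := (relation_iff (F := fun p => AlternatingMap.pi (ν p)) ω₀ ρ hμ.morphism.degree
    (fun a => by simpa using hμ.hamiltonian a) r a).1 (hμ.morphism.relation r a)
  rw [h, pi_bar_succ]
  rfl

end MainTheorem

end Multisymp

theorem mainTheorem4 {d : ℕ} {X : Type*} [TopologicalSpace X]
    [ChartedSpace (EuclideanSpace ℝ (Fin d)) X] [IsManifold (𝓡 d) ∞ X]
    [T2Space X] [SecondCountableTopology X]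
    {𝔤 : Type*} [LieRing 𝔤] [LieAlgebra ℝ 𝔤]
    {n : ℕ} (hn : 1 ≤ n)
    (ω₀ : Multisymp.Form C^∞⟮𝓡 d, X; ℝ⟯ (n + 1)) (hω : Multisymp.extD ω₀ = 0)
    (ρ : 𝔤 →ₗ⁅ℝ⁆ Multisymp.VF C^∞⟮𝓡 d, X; ℝ⟯) :
    (Multisymp.IsPremultisymplectic ω₀ ρ ↔ Multisymp.dBar (Multisymp.bar ρ ω₀) = 0) ∧
    (Multisymp.IsHamiltonian ω₀ ρ ↔
      ∃ ν ∈ Multisymp.totalDegree C^∞⟮𝓡 d, X; ℝ⟯ 𝔤 n,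
        Multisymp.dBar ν = Multisymp.bar ρ ω₀) ∧
    (∀ ν ∈ Multisymp.totalDegree C^∞⟮𝓡 d, X; ℝ⟯ 𝔤 n,
      Multisymp.dBar ν = Multisymp.bar ρ ω₀ →
        Multisymp.IsHomotopyMomentumMap ω₀ ρ (fun i =>
          (-(-1 : ℝ) ^ (i * (i + 1) / 2)) •
            (Multisymp.incl C^∞⟮𝓡 d, X; ℝ⟯ (n - i)).compAlternatingMap (ν i (n - i)))) :=
  ⟨Multisymp.isPremultisymplectic_iff_dBar ω₀ hω ρ,
    ⟨fun ⟨_, hμ⟩ => Multisymp.exists_dBar_eq_of_isHomotopyMomentumMap ω₀ ρ hμ,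
      fun ⟨_, hν, h⟩ => ⟨_, Multisymp.isHomotopyMomentumMap_of_dBar_eq ω₀ ρ hω hν h⟩⟩,
    fun _ hν h => Multisymp.isHomotopyMomentumMap_of_dBar_eq ω₀ ρ hω hν h⟩
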